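/- **Theorem 5.3.** Let $\lambda_1,\lambda_2>0$ satisfy $\frac14<\frac{\lambda_2}{\lambda_1}<1$ or $1<\frac{\lambda_2}{\lambda_1}<4$. Consider pairs of real functions $y_1,y_2\in C^\infty([0,1])$ (smooth up to both endpoints) and write $K=e^{y_1}$, $\phi=e^{y_2}$. Then there is at most one such pair $(y_1,y_2)$ on $[0,1]$ satisfying, for all $x\in(0,1)$, $$y_1''+\tfrac16(y_1')^2+\tfrac13(y_2')^2-\frac{1+3x^2}{x(1-x^2)}\,y_1'=0,$$ $$y_1''+\tfrac12(y_1')^2-\frac{5+7x^2}{x(1-x^2)}\,y_1'+\frac{8}{(1-x^2)^2}\left(6-8K^{-1/3}\phi^{-1/3}+2K^{-1/3}\phi^{-4/3}\right)=0,$$ $$y_2''+\tfrac12\,y_1'y_2'-\frac{2(1+2x^2)}{x(1-x^2)}\,y_2'+\frac{32}{(1-x^2)^2}\,K^{-1/3}\phi^{-1/3}\left(\phi^{-1}-1\right)=0,$$ together with the boundary conditions $$\phi(0)=\frac{\lambda_2}{\lambda_1},\qquad K(1)=\phi(1)=1,\qquad y_1'(0)=y_2'(0)=y_1'(1)=y_2'(1)=0.$$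 (These are the Einstein equations on the $4$-ball with conformal infinity the Berger metric $\lambda_1\sigma_1^2+\lambda_2(\sigma_2^2+\sigma_3^2)$ on $S^3$.) -/

import Mathlib

open Set
open scoped ContDiff

/-- The derivative on the closed interval `[0,1]` (one-sided at the two endpoints). -/
noncomputable def dI (y : ℝ → ℝ) : ℝ → ℝ := derivWithin y (Icc 0 1)

/-- `(y₁, y₂) = (log K, log φ)` solves the boundary value problem of the Berger-sphere Einstein
equations on `[0,1]`, with conformal infinity `lam₁ σ₁² + lam₂ (σ₂² + σ₃²)`. The functions are
smooth up to both endpoints; the equations, whose coefficients are singular at `0` and `1`, hold on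
the open interval. Only the values on `[0,1]` matter. Here `K = exp y₁` and `φ = exp y₂`. -/
structure IsBergerSolution (lam₁ lam₂ : ℝ) (y₁ y₂ : ℝ → ℝ) : Prop where
  smooth₁ : ContDiffOn ℝ ∞ y₁ (Icc 0 1)
  smooth₂ : ContDiffOn ℝ ∞ y₂ (Icc 0 1)
  eq₁ : ∀ x ∈ Ioo (0 : ℝ) 1,
    dI (dI y₁) x + 1 / 6 * (dI y₁ x) ^ 2 + 1 / 3 * (dI y₂ x) ^ 2
      - x⁻¹ * (1 + 3 * x ^ 2) * (1 - x ^ 2)⁻¹ * dI y₁ x = 0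
  eq₂ : ∀ x ∈ Ioo (0 : ℝ) 1, ∀ K φ : ℝ, K = Real.exp (y₁ x) → φ = Real.exp (y₂ x) →
    dI (dI y₁) x + 1 / 2 * (dI y₁ x) ^ 2
      - x⁻¹ * (5 + 7 * x ^ 2) * (1 - x ^ 2)⁻¹ * dI y₁ x
      + 8 * ((1 - x ^ 2) ^ 2)⁻¹ *
        (6 - 8 * K ^ (-(1 / 3) : ℝ) * φ ^ (-(1 / 3) : ℝ)
          + 2 * K ^ (-(1 / 3) : ℝ) * φ ^ (-(4 / 3) : ℝ)) = 0
  eq₃ : ∀ x ∈ Ioo (0 : ℝ) 1, ∀ K φ : ℝ, K = Real.exp (y₁ x) → φ = Real.exp (y₂ x) →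
    dI (dI y₂) x + 1 / 2 * dI y₁ x * dI y₂ x
      - 2 * x⁻¹ * (1 + 2 * x ^ 2) * (1 - x ^ 2)⁻¹ * dI y₂ x
      + 32 * ((1 - x ^ 2) ^ 2)⁻¹ * K ^ (-(1 / 3) : ℝ) * φ ^ (-(1 / 3) : ℝ) * (φ⁻¹ - 1) = 0
  phi_zero : Real.exp (y₂ 0) = lam₂ / lam₁
  K_one : Real.exp (y₁ 1) = 1
  phi_one : Real.exp (y₂ 1) = 1
  deriv₁_zero : dI y₁ 0 = 0
  deriv₂_zero : dI y₂ 0 = 0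
  deriv₁_one : dI y₁ 1 = 0
  deriv₂_one : dI y₂ 1 = 0

/-!
The boundary value problem describes the `U(2)`-invariant Einstein metrics
`dr² + A² σ₁² + B² (σ₂² + σ₃²)` on the ball, with `r = -log x`, and these can be integrated
explicitly: they are the Taub-NUT-AdS metrics. The natural coordinate is `P = B B_r / A`, which
equals `1` at the centre `x = 1` because of the boundary conditions there.

The relation `R_rr = R_11` between Ricci components says that `(P² - 1) / B²` is constant along a
solution. Its value can be read off at conformal infinity, where `B_r ∼ B` and `B² / A² = φ(0)`, and
is `C = φ(0) = λ₂ / λ₁` (`Berger.nutCoord_sq`). Therefore `P_r = C A`, so that `P` increases from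
`1`. As a function of `P`, the quantity `A²` satisfies a linear first-order equation by the
Hamiltonian constraint; since `A = 0` at the centre its solution is
`C² A² = (P - 1) ((P - 1) (P + 3) + 4 C) / (P + 1)` (`Berger.fiberRadius_sq`). Now `P` satisfies an
autonomous equation, which for `T = √(P - 1)` has a continuous positive right-hand side depending on
`C` only (`Berger.hasDerivAt_sqrt_nutCoord`), with `T = 0` at the centre. Separation of variables
(`Berger.eq_of_autonomous`) determines `T`, hence `P`, then `A` and `B`, and finally `K` and `φ`.
-/

namespace Berger

/-- Radius `A` of the Hopf fibre. With `r = -log x` the distance from the centre, so that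
`sinh r = (1 - x²) / (2 x)`, and `σ₁² + σ₂² + σ₃²` the unit round metric on `S³`, the Einstein
metric is `dr² + A² σ₁² + B² (σ₂² + σ₃²)`, where `A² B⁴ = K sinh⁶ r` and `B² = φ A²`. Here
`u = log K` and `v = log φ`. -/
noncomputable def fiberRadius (u v : ℝ → ℝ) (x : ℝ) : ℝ :=
  (1 - x ^ 2) / (2 * x) * Real.exp ((u x - 2 * v x) / 6)

/-- Radius `B` in the `σ₂` and `σ₃` directions, in the normalisation of `fiberRadius`. -/
noncomputable def baseRadius (u v : ℝ → ℝ) (x : ℝ) : ℝ :=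
  (1 - x ^ 2) / (2 * x) * Real.exp ((u x + v x) / 6)

/-- Logarithmic derivative of `fiberRadius` in the variable `r = -log x`. -/
noncomputable def fiberRate (u v : ℝ → ℝ) (x : ℝ) : ℝ :=
  (1 + x ^ 2) / (1 - x ^ 2) - x * (dI u x - 2 * dI v x) / 6

/-- Logarithmic derivative of `baseRadius` in the variable `r = -log x`. -/
noncomputable def baseRate (u v : ℝ → ℝ) (x : ℝ) : ℝ :=
  (1 + x ^ 2) / (1 - x ^ 2) - x * (dI u x + dI v x) / 6

/-- The Taub-NUT radial coordinate `P = B B_r / A`, written so that it is also meaningful at the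
centre `x = 1`, where `A` and `B` vanish. -/
noncomputable def nutCoord (u v : ℝ → ℝ) (x : ℝ) : ℝ :=
  Real.exp ((u x + 4 * v x) / 6) *
    ((1 + x ^ 2) / (2 * x) - (1 - x ^ 2) * (dI u x + dI v x) / 12)

/-! ### Calculus on the closed interval -/

theorem hasDerivAt_dI {y : ℝ → ℝ} (hy : ContDiffOn ℝ ∞ y (Icc 0 1)) {x : ℝ}
    (hx : x ∈ Ioo (0 : ℝ) 1) : HasDerivAt y (dI y x) x := by
  have hd : DifferentiableOn ℝ y (Icc 0 1) := hy.differentiableOn (by simp)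
  exact (hd x (Ioo_subset_Icc_self hx)).hasDerivWithinAt.hasDerivAt (Icc_mem_nhds hx.1 hx.2)

theorem contDiffOn_dI {y : ℝ → ℝ} (hy : ContDiffOn ℝ ∞ y (Icc 0 1)) :
    ContDiffOn ℝ ∞ (dI y) (Icc 0 1) :=
  hy.derivWithin (uniqueDiffOn_Icc zero_lt_one) (by simp)

theorem eq_of_hasDerivAt_zero {f : ℝ → ℝ} {a b : ℝ} (hab : a < b)
    (hc : ContinuousOn f (Icc a b)) (hd : ∀ x ∈ Ioo a b, HasDerivAt f 0 x) : f a = f b := by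
  obtain ⟨c, -, hc⟩ := exists_hasDerivAt_eq_slope f (fun _ => 0) hab hc hd
  have : b - a ≠ 0 := sub_ne_zero.2 hab.ne'
  field_simp at hc
  linarith

/-- Uniqueness for `x T' = -F(T)` with `F` positive and the initial value given at `x = 1`: the time
map `∫₀ᵀ ds / F(s)` of a solution is `-log x`. -/
theorem eq_of_autonomous {F T₁ T₂ : ℝ → ℝ} (hF : Continuous F) (hpos : ∀ t, 0 < F t)
    (hc₁ : ContinuousOn T₁ (Ioc 0 1)) (hc₂ : ContinuousOn T₂ (Ioc 0 1))
    (h₁ : T₁ 1 = 0) (h₂ : T₂ 1 = 0)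
    (hd₁ : ∀ x ∈ Ioo (0 : ℝ) 1, HasDerivAt T₁ (-F (T₁ x) / x) x)
    (hd₂ : ∀ x ∈ Ioo (0 : ℝ) 1, HasDerivAt T₂ (-F (T₂ x) / x) x)
    {x : ℝ} (hx : x ∈ Ioo (0 : ℝ) 1) : T₁ x = T₂ x := by
  have hFi : Continuous fun t => (F t)⁻¹ := hF.inv₀ fun t => (hpos t).ne'
  set G : ℝ → ℝ := fun t => ∫ s in (0 : ℝ)..t, (F s)⁻¹ with hG
  have hGd : ∀ t, HasDerivAt G (F t)⁻¹ t := fun t =>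
    (hFi.integral_hasStrictDerivAt 0 t).hasDerivAt
  have hGm : StrictMono G := strictMono_of_deriv_pos fun t => by
    rw [(hGd t).deriv]; exact inv_pos.2 (hpos t)
  have hGc : Continuous G := continuous_iff_continuousAt.2 fun t => (hGd t).continuousAt
  have key : ∀ T : ℝ → ℝ, ContinuousOn T (Ioc 0 1) → T 1 = 0 →
      (∀ x ∈ Ioo (0 : ℝ) 1, HasDerivAt T (-F (T x) / x) x) → G (T x) + Real.log x = 0 := by
    intro T hc h1 hd
    have hsub : Icc x 1 ⊆ Ioc 0 1 := fun z hz => ⟨hx.1.trans_le hz.1, hz.2⟩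
    have := eq_of_hasDerivAt_zero (f := fun z => G (T z) + Real.log z) hx.2
      ((hGc.comp_continuousOn (hc.mono hsub)).add
        (Real.continuousOn_log.mono fun z hz => (hsub hz).1.ne')) fun z hz => by
      have hz0 : 0 < z := hx.1.trans hz.1
      refine (((hGd (T z)).comp z (hd z ⟨hz0, hz.2⟩)).add
        (Real.hasDerivAt_log hz0.ne')).congr_deriv ?_
      have := (hpos (T z)).ne'
      field_simp
      ring
    simpa [h1, hG] using this
  apply hGm.injective
  linarith [key T₁ hc₁ h₁ hd₁, key T₂ hc₂ h₂ hd₂]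

/-! ### Radii of the metric -/

theorem fiberRadius_pos (u v : ℝ → ℝ) {x : ℝ} (hx : x ∈ Ioo (0 : ℝ) 1) :
    0 < fiberRadius u v x := by
  have h0 := hx.1
  have : 0 < 1 - x ^ 2 := by nlinarith [hx.1, hx.2]
  unfold fiberRadius; positivity

theorem baseRadius_pos (u v : ℝ → ℝ) {x : ℝ} (hx : x ∈ Ioo (0 : ℝ) 1) :
    0 < baseRadius u v x := by
  have h0 := hx.1
  have : 0 < 1 - x ^ 2 := by nlinarith [hx.1, hx.2]
  unfold baseRadius; positivity

theorem nutCoord_eq (u v : ℝ → ℝ) {x : ℝ} (hx : x ∈ Ioo (0 : ℝ) 1) :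
    nutCoord u v x = baseRadius u v x ^ 2 / fiberRadius u v x * baseRate u v x := by
  have h0 : x ≠ 0 := hx.1.ne'
  have h1 : 1 - x ^ 2 ≠ 0 := by nlinarith [hx.1, hx.2]
  have he : Real.exp ((u x + v x) / 6) ^ 2 =
      Real.exp ((u x + 4 * v x) / 6) * Real.exp ((u x - 2 * v x) / 6) := by
    rw [← Real.exp_nat_mul, ← Real.exp_add]; congr 1; push_cast; ring
  have hA := Real.exp_ne_zero ((u x - 2 * v x) / 6)
  unfold nutCoord baseRadius fiberRadius baseRate
  rw [mul_pow, he]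
  field_simp
  ring

/-- Derivative of `sinh r · exp g`, the common shape of both radii. -/
theorem hasDerivAt_sinh_mul_exp {g : ℝ → ℝ} {g' x : ℝ} (hx : x ∈ Ioo (0 : ℝ) 1)
    (hg : HasDerivAt g g' x) :
    HasDerivAt (fun x => (1 - x ^ 2) / (2 * x) * Real.exp (g x))
      (-((1 - x ^ 2) / (2 * x) * Real.exp (g x)) * ((1 + x ^ 2) / (1 - x ^ 2) - x * g') / x) x := by
  have h0 : x ≠ 0 := hx.1.ne'
  have h1 : 1 - x ^ 2 ≠ 0 := by nlinarith [hx.1, hx.2]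
  have hs := (((hasDerivAt_id x).pow 2).const_sub 1).div ((hasDerivAt_id x).const_mul 2)
    (by simpa using h0)
  refine (hs.mul hg.exp).congr_deriv ?_
  simp only [Pi.pow_apply, Pi.div_apply, id]
  field_simp
  ring

section Solution

variable {lam₁ lam₂ : ℝ} {u v : ℝ → ℝ}

theorem hasDerivAt_fiberRadius (h : IsBergerSolution lam₁ lam₂ u v) {x : ℝ}
    (hx : x ∈ Ioo (0 : ℝ) 1) :
    HasDerivAt (fiberRadius u v) (-fiberRadius u v x * fiberRate u v x / x) x := by
  have := hasDerivAt_sinh_mul_exp hx (((hasDerivAt_dI h.smooth₁ hx).sub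
    ((hasDerivAt_dI h.smooth₂ hx).const_mul 2)).div_const 6)
  refine this.congr_deriv ?_
  unfold fiberRadius fiberRate
  simp only [Pi.sub_apply]
  ring

theorem hasDerivAt_baseRadius (h : IsBergerSolution lam₁ lam₂ u v) {x : ℝ}
    (hx : x ∈ Ioo (0 : ℝ) 1) :
    HasDerivAt (baseRadius u v) (-baseRadius u v x * baseRate u v x / x) x := by
  have := hasDerivAt_sinh_mul_exp hx (((hasDerivAt_dI h.smooth₁ hx).add
    (hasDerivAt_dI h.smooth₂ hx)).div_const 6)
  refine this.congr_deriv ?_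
  unfold baseRadius baseRate
  simp only [Pi.add_apply]
  ring

theorem exp_rpow_mul (a b s t : ℝ) :
    Real.exp a ^ s * Real.exp b ^ t = Real.exp (a * s + b * t) := by
  rw [← Real.exp_mul, ← Real.exp_mul, ← Real.exp_add]

theorem inv_baseRadius_sq (u v : ℝ → ℝ) {x : ℝ} (hx : x ∈ Ioo (0 : ℝ) 1) :
    1 / baseRadius u v x ^ 2 =
      4 * x ^ 2 / (1 - x ^ 2) ^ 2 * Real.exp (-((u x + v x) / 3)) := by
  have h0 : x ≠ 0 := hx.1.ne'
  have h1 : 1 - x ^ 2 ≠ 0 := by nlinarith [hx.1, hx.2]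
  have he : Real.exp (-((u x + v x) / 3)) * Real.exp ((u x + v x) / 6) ^ 2 = 1 := by
    rw [← Real.exp_nat_mul, ← Real.exp_add, Real.exp_eq_one_iff]; push_cast; ring
  have hne := Real.exp_ne_zero ((u x + v x) / 6)
  unfold baseRadius
  generalize Real.exp (-((u x + v x) / 3)) = E at *
  field_simp
  linear_combination -4 * he

theorem fiberRadius_sq_div (u v : ℝ → ℝ) {x : ℝ} (hx : x ∈ Ioo (0 : ℝ) 1) :
    fiberRadius u v x ^ 2 / baseRadius u v x ^ 4 =
      4 * x ^ 2 / (1 - x ^ 2) ^ 2 * Real.exp (-((u x + 4 * v x) / 3)) := by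
  have h0 : x ≠ 0 := hx.1.ne'
  have h1 : 1 - x ^ 2 ≠ 0 := by nlinarith [hx.1, hx.2]
  have he : Real.exp (-((u x + 4 * v x) / 3)) * Real.exp ((u x + v x) / 6) ^ 4 =
      Real.exp ((u x - 2 * v x) / 6) ^ 2 := by
    rw [← Real.exp_nat_mul, ← Real.exp_nat_mul, ← Real.exp_add]; congr 1; push_cast; ring
  have hne := Real.exp_ne_zero ((u x + v x) / 6)
  unfold baseRadius fiberRadius
  generalize Real.exp (-((u x + 4 * v x) / 3)) = J at *
  field_simp
  linear_combination -4 * he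

/-! ### The Einstein equations in terms of the radii -/

/-- The second equation with the potential expressed by exponentials. -/
theorem eq₂_exp (h : IsBergerSolution lam₁ lam₂ u v) {x : ℝ} (hx : x ∈ Ioo (0 : ℝ) 1) :
    dI (dI u) x + 1 / 2 * dI u x ^ 2 - x⁻¹ * (5 + 7 * x ^ 2) * (1 - x ^ 2)⁻¹ * dI u x +
      8 / (1 - x ^ 2) ^ 2 * (6 - 8 * Real.exp (-((u x + v x) / 3)) +
        2 * Real.exp (-((u x + 4 * v x) / 3))) = 0 := by
  have e := h.eq₂ x hx _ _ rfl rfl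
  have h1 := exp_rpow_mul (u x) (v x) (-(1 / 3)) (-(1 / 3))
  have h2 := exp_rpow_mul (u x) (v x) (-(1 / 3)) (-(4 / 3))
  rw [show u x * -(1 / 3) + v x * -(1 / 3) = -((u x + v x) / 3) by ring] at h1
  rw [show u x * -(1 / 3) + v x * -(4 / 3) = -((u x + 4 * v x) / 3) by ring] at h2
  rw [← h1, ← h2, ← e]
  ring

/-- The third equation with the potential expressed by exponentials. -/
theorem eq₃_exp (h : IsBergerSolution lam₁ lam₂ u v) {x : ℝ} (hx : x ∈ Ioo (0 : ℝ) 1) :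
    dI (dI v) x + 1 / 2 * dI u x * dI v x - 2 * x⁻¹ * (1 + 2 * x ^ 2) * (1 - x ^ 2)⁻¹ * dI v x +
      32 / (1 - x ^ 2) ^ 2 * (Real.exp (-((u x + 4 * v x) / 3)) -
        Real.exp (-((u x + v x) / 3))) = 0 := by
  have e := h.eq₃ x hx _ _ rfl rfl
  have h1 := exp_rpow_mul (u x) (v x) (-(1 / 3)) (-(1 / 3))
  have h2 : Real.exp (-((u x + v x) / 3)) * (Real.exp (v x))⁻¹ =
      Real.exp (-((u x + 4 * v x) / 3)) := by
    rw [← Real.exp_neg, ← Real.exp_add]; congr 1; ring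
  rw [show u x * -(1 / 3) + v x * -(1 / 3) = -((u x + v x) / 3) by ring] at h1
  rw [← h2, ← h1, ← e]
  ring

/-- The Hamiltonian constraint (the `rr` component of the Einstein tensor), which is the difference
of the first two equations. -/
theorem constraint (h : IsBergerSolution lam₁ lam₂ u v) {x : ℝ} (hx : x ∈ Ioo (0 : ℝ) 1) :
    2 * fiberRate u v x * baseRate u v x + baseRate u v x ^ 2 =
      3 + 4 / baseRadius u v x ^ 2 - fiberRadius u v x ^ 2 / baseRadius u v x ^ 4 := by
  have h0 : x ≠ 0 := hx.1.ne'
  have h1 : 1 - x ^ 2 ≠ 0 := by nlinarith [hx.1, hx.2]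
  have e1 := h.eq₁ x hx
  have e2 := eq₂_exp h hx
  rw [fiberRadius_sq_div u v hx, ← mul_one_div 4, inv_baseRadius_sq u v hx]
  unfold fiberRate baseRate
  generalize Real.exp (-((u x + v x) / 3)) = E at *
  generalize Real.exp (-((u x + 4 * v x) / 3)) = J at *
  have e : _ - _ = (0 : ℝ) := sub_eq_zero.2 (e2.trans e1.symm)
  rw [← sub_eq_zero]
  refine Eq.trans ?_ ((congrArg (x ^ 2 / 4 * ·) e).trans (mul_zero _))
  field_simp
  ring

/-- The relation `R_rr = R_11` between components of the Ricci tensor, which is `3 / 2` times the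
first equation minus half the second plus the third. -/
theorem hasDerivAt_baseRate (h : IsBergerSolution lam₁ lam₂ u v) {x : ℝ}
    (hx : x ∈ Ioo (0 : ℝ) 1) :
    HasDerivAt (baseRate u v) ((baseRate u v x ^ 2 - fiberRate u v x * baseRate u v x +
      fiberRadius u v x ^ 2 / baseRadius u v x ^ 4) / x) x := by
  have h0 : x ≠ 0 := hx.1.ne'
  have h1 : 1 - x ^ 2 ≠ 0 := by nlinarith [hx.1, hx.2]
  have hp := hasDerivAt_dI (contDiffOn_dI h.smooth₁) hx
  have hq := hasDerivAt_dI (contDiffOn_dI h.smooth₂) hx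
  have hx2 := (hasDerivAt_id x).pow 2
  have hd := ((hx2.const_add 1).div (hx2.const_sub 1) h1).sub
    (((hasDerivAt_id x).mul (hp.add hq)).div_const 6)
  refine hd.congr_deriv ?_
  have e1 := h.eq₁ x hx
  have e2 := eq₂_exp h hx
  have e3 := eq₃_exp h hx
  rw [fiberRadius_sq_div u v hx]
  unfold fiberRate baseRate
  simp only [Pi.pow_apply, Pi.add_apply, id]
  generalize Real.exp (-((u x + v x) / 3)) = E at *
  generalize Real.exp (-((u x + 4 * v x) / 3)) = J at *
  have e : (3 / 2 : ℝ) * _ - 1 / 2 * _ + _ = 0 :=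
    (congrArg₂ (· + ·) (congrArg₂ (3 / 2 * · - 1 / 2 * ·) e1 e2) e3).trans (by norm_num)
  rw [← sub_eq_zero]
  refine Eq.trans ?_ ((congrArg (-(x / 6) * ·) e).trans (mul_zero _))
  clear e e1 e2 e3
  field_simp
  ring

/-- The relation `R_rr = R_11` in terms of `P`: it says that the ratio `(P² - 1) / B²`, on which the
right-hand side depends, is a first integral. -/
theorem hasDerivAt_nutCoord_of_radii (h : IsBergerSolution lam₁ lam₂ u v) {x : ℝ}
    (hx : x ∈ Ioo (0 : ℝ) 1) :
    HasDerivAt (nutCoord u v) (-(fiberRadius u v x *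
      ((nutCoord u v x ^ 2 - 1) / baseRadius u v x ^ 2)) / x) x := by
  have h0 : x ≠ 0 := hx.1.ne'
  have hA := (fiberRadius_pos u v hx).ne'
  have hB := (baseRadius_pos u v hx).ne'
  have hd := (((hasDerivAt_baseRadius h hx).pow 2).div (hasDerivAt_fiberRadius h hx) hA).mul
    (hasDerivAt_baseRate h hx)
  have heq : nutCoord u v =ᶠ[nhds x]
      (baseRadius u v ^ 2 / fiberRadius u v) * baseRate u v := by
    filter_upwards [Ioo_mem_nhds hx.1 hx.2] with z hz
    exact nutCoord_eq u v hz
  refine (hd.congr_of_eventuallyEq heq).congr_deriv ?_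
  rw [nutCoord_eq u v hx]
  simp only [Pi.pow_apply, Pi.div_apply]
  field_simp
  ring

/-! ### First integrals -/
theorem continuousOn_fiberRadius (h : IsBergerSolution lam₁ lam₂ u v) :
    ContinuousOn (fiberRadius u v) (Ioc 0 1) := by
  have hu := h.smooth₁.continuousOn.mono (Ioc_subset_Icc_self (a := (0 : ℝ)) (b := 1))
  have hv := h.smooth₂.continuousOn.mono (Ioc_subset_Icc_self (a := (0 : ℝ)) (b := 1))
  unfold fiberRadius
  have : ∀ x ∈ Ioc (0 : ℝ) 1, 2 * x ≠ 0 := fun x hx => by linarith [hx.1]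
  fun_prop (disch := assumption)

theorem continuousOn_nutCoord (h : IsBergerSolution lam₁ lam₂ u v) :
    ContinuousOn (nutCoord u v) (Ioc 0 1) := by
  have hs := Ioc_subset_Icc_self (a := (0 : ℝ)) (b := 1)
  have hu := h.smooth₁.continuousOn.mono hs
  have hv := h.smooth₂.continuousOn.mono hs
  have hp := (contDiffOn_dI h.smooth₁).continuousOn.mono hs
  have hq := (contDiffOn_dI h.smooth₂).continuousOn.mono hs
  unfold nutCoord
  have : ∀ x ∈ Ioc (0 : ℝ) 1, 2 * x ≠ 0 := fun x hx => by linarith [hx.1]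
  fun_prop (disch := assumption)

theorem nutCoord_one (h : IsBergerSolution lam₁ lam₂ u v) : nutCoord u v 1 = 1 := by
  have hu : u 1 = 0 := Real.exp_eq_one_iff _ |>.1 h.K_one
  have hv : v 1 = 0 := Real.exp_eq_one_iff _ |>.1 h.phi_one
  simp [nutCoord, hu, hv]

/-- The first integral `(P² - 1) / B²`, evaluated at conformal infinity `x = 0`. -/
theorem nutCoord_sq (h : IsBergerSolution lam₁ lam₂ u v) {x : ℝ} (hx : x ∈ Ioo (0 : ℝ) 1) :
    nutCoord u v x ^ 2 = 1 + Real.exp (v 0) * baseRadius u v x ^ 2 := by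
  have hs : Icc 0 x ⊆ Icc 0 1 := Icc_subset_Icc_right hx.2.le
  have hu := h.smooth₁.continuousOn.mono hs
  have hv := h.smooth₂.continuousOn.mono hs
  have hp := (contDiffOn_dI h.smooth₁).continuousOn.mono hs
  have hq := (contDiffOn_dI h.smooth₂).continuousOn.mono hs
  -- `(x² P² - x²) / (x² B²)`, written without division by `x` so as to extend to `x = 0`
  set Q : ℝ → ℝ := fun z => ((Real.exp ((u z + 4 * v z) / 6) *
    ((1 + z ^ 2) / 2 - z * (1 - z ^ 2) * (dI u z + dI v z) / 12)) ^ 2 - z ^ 2) /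
      ((1 - z ^ 2) / 2 * Real.exp ((u z + v z) / 6)) ^ 2 with hQ
  have hQx : ∀ z ∈ Ioo (0 : ℝ) 1, Q z = (nutCoord u v z ^ 2 - 1) / baseRadius u v z ^ 2 := by
    intro z hz
    have h0 : z ≠ 0 := hz.1.ne'
    have h1 : 1 - z ^ 2 ≠ 0 := by nlinarith [hz.1, hz.2]
    have := Real.exp_ne_zero ((u z + v z) / 6)
    simp only [hQ, nutCoord, baseRadius]
    field_simp
  have hne : ∀ z ∈ Icc 0 x, ((1 - z ^ 2) / 2 * Real.exp ((u z + v z) / 6)) ^ 2 ≠ 0 := by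
    intro z hz
    have : 0 < 1 - z ^ 2 := by nlinarith [hz.1, hz.2, hx.2]
    positivity
  have hcont : ContinuousOn Q (Icc 0 x) := by
    simp only [hQ]
    fun_prop (disch := assumption)
  have hconst := eq_of_hasDerivAt_zero hx.1 hcont fun z hz => by
    have hz' : z ∈ Ioo (0 : ℝ) 1 := ⟨hz.1, hz.2.trans hx.2⟩
    have h0 : z ≠ 0 := hz.1.ne'
    have hA := (fiberRadius_pos u v hz').ne'
    have hB := (baseRadius_pos u v hz').ne'
    have hd := (((hasDerivAt_nutCoord_of_radii h hz').pow 2).sub_const 1).div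
      ((hasDerivAt_baseRadius h hz').pow 2) (pow_ne_zero 2 hB)
    have heq : Q =ᶠ[nhds z] fun z => (nutCoord u v z ^ 2 - 1) / baseRadius u v z ^ 2 := by
      filter_upwards [Ioo_mem_nhds hz'.1 hz'.2] with w hw using hQx w hw
    refine (hd.congr_of_eventuallyEq heq).congr_deriv ?_
    simp only [Pi.pow_apply]
    have hPA := nutCoord_eq u v hz'
    rw [div_mul_eq_mul_div, eq_div_iff hA] at hPA
    generalize fiberRadius u v z = A at *
    generalize baseRadius u v z = B at *
    generalize nutCoord u v z = P at *
    field_simp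
    push_cast
    linear_combination 2 * (1 - P ^ 2) * hPA
  have hQ0 : Q 0 = Real.exp (v 0) := by
    have he : Real.exp ((u 0 + 4 * v 0) / 6) ^ 2 =
        Real.exp (v 0) * Real.exp ((u 0 + v 0) / 6) ^ 2 := by
      rw [← Real.exp_nat_mul, ← Real.exp_nat_mul, ← Real.exp_add]; congr 1; push_cast; ring
    have := Real.exp_ne_zero ((u 0 + v 0) / 6)
    simp only [hQ]
    rw [div_eq_iff (by positivity)]
    linear_combination he / 4
  have hB := (baseRadius_pos u v hx).ne'
  rw [hQ0, hQx x hx, eq_div_iff (by positivity)] at hconst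
  linarith

theorem hasDerivAt_nutCoord (h : IsBergerSolution lam₁ lam₂ u v) {x : ℝ}
    (hx : x ∈ Ioo (0 : ℝ) 1) :
    HasDerivAt (nutCoord u v) (-(Real.exp (v 0) * fiberRadius u v x) / x) x := by
  have hB := (baseRadius_pos u v hx).ne'
  refine (hasDerivAt_nutCoord_of_radii h hx).congr_deriv ?_
  rw [nutCoord_sq h hx]
  field_simp
  ring

/-- The sign of `P` is not decided by `nutCoord_sq`; it follows from `P = 1` at the centre together
with monotonicity. -/
theorem one_lt_nutCoord (h : IsBergerSolution lam₁ lam₂ u v) {x : ℝ} (hx : x ∈ Ioo (0 : ℝ) 1) :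
    1 < nutCoord u v x := by
  have hanti : StrictAntiOn (nutCoord u v) (Ioc 0 1) := by
    refine strictAntiOn_of_deriv_neg (convex_Ioc 0 1) (continuousOn_nutCoord h) fun z hz => ?_
    rw [interior_Ioc] at hz
    rw [(hasDerivAt_nutCoord h hz).deriv]
    have := mul_pos (Real.exp_pos (v 0)) (fiberRadius_pos u v hz)
    exact div_neg_of_neg_of_pos (neg_neg_of_pos this) hz.1
  simpa only [nutCoord_one h] using hanti ⟨hx.1, hx.2.le⟩ ⟨one_pos, le_rfl⟩ hx.2

/-- The Taub-NUT potential: `A²` as a function of `P`. In terms of `P` the constraint is a linear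
first-order equation for `A²`; its integration constant, the mass, is fixed at the centre. -/
theorem fiberRadius_sq (h : IsBergerSolution lam₁ lam₂ u v) {x : ℝ} (hx : x ∈ Ioo (0 : ℝ) 1) :
    (Real.exp (v 0) * fiberRadius u v x) ^ 2 * (nutCoord u v x + 1) =
      (nutCoord u v x - 1) *
        ((nutCoord u v x - 1) * (nutCoord u v x + 3) + 4 * Real.exp (v 0)) := by
  have hsub : Icc x 1 ⊆ Ioc 0 1 := fun z hz => ⟨hx.1.trans_le hz.1, hz.2⟩
  have hcA := (continuousOn_fiberRadius h).mono hsub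
  have hcP := (continuousOn_nutCoord h).mono hsub
  have hP : ∀ z ∈ Icc x 1, nutCoord u v z ≠ 0 := by
    intro z hz
    rcases hz.2.eq_or_lt with rfl | hlt
    · rw [nutCoord_one h]; exact one_ne_zero
    · exact (one_pos.trans (one_lt_nutCoord h ⟨(hsub hz).1, hlt⟩)).ne'
  set C := Real.exp (v 0) with hC
  have hCpos : 0 < C := Real.exp_pos _
  -- `C² A² (P² - 1) / P` minus the primitive of `3 (P² - 1)² / P² + 4 C (P² - 1) / P²` vanishing
  -- at `P = 1`; the linear equation for `A²` has integrating factor `(P² - 1) / P`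
  set N : ℝ → ℝ := fun z =>
    (C ^ 2 * fiberRadius u v z ^ 2 * (nutCoord u v z ^ 2 - 1) -
      (nutCoord u v z - 1) ^ 3 * (nutCoord u v z + 3) - 4 * C * (nutCoord u v z - 1) ^ 2) /
        nutCoord u v z with hN
  have hcont : ContinuousOn N (Icc x 1) := by
    simp only [hN]
    fun_prop (disch := assumption)
  have hconst := eq_of_hasDerivAt_zero hx.2 hcont fun z hz => by
    have hz' : z ∈ Ioo (0 : ℝ) 1 := ⟨hx.1.trans hz.1, hz.2⟩
    have h0 : z ≠ 0 := hz'.1.ne'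
    have hPz := hP z (Ioo_subset_Icc_self hz)
    have hB := (baseRadius_pos u v hz').ne'
    have hA := (fiberRadius_pos u v hz').ne'
    have hdA := hasDerivAt_fiberRadius h hz'
    have hdP := hasDerivAt_nutCoord h hz'
    rw [← hC] at hdP
    have hd := (((((hdA.pow 2).const_mul (C ^ 2)).mul ((hdP.pow 2).sub_const 1)).sub
      (((hdP.sub_const 1).pow 3).mul (hdP.add_const 3))).sub
        (((hdP.sub_const 1).pow 2).const_mul (4 * C))).div hdP hPz
    refine hd.congr_deriv ?_
    have hsq := nutCoord_sq h hz'
    have hPB := nutCoord_eq u v hz'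
    have hcon := constraint h hz'
    simp only [Pi.pow_apply, Pi.mul_apply, Pi.sub_apply]
    rw [← hC] at hsq
    generalize fiberRadius u v z = A at *
    generalize baseRadius u v z = B at *
    generalize nutCoord u v z = P at *
    generalize fiberRate u v z = a at *
    generalize baseRate u v z = b at *
    rw [div_mul_eq_mul_div, eq_div_iff hA] at hPB
    field_simp at hcon
    -- the constraint in terms of `P`, `A` and `a` alone
    have k : 2 * a * A * B ^ 2 * P + A ^ 2 * (P ^ 2 + 1) - 3 * B ^ 4 - 4 * B ^ 2 = 0 := by
      linear_combination hcon + (2 * a * B ^ 2 + P * A + B ^ 2 * b) * hPB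
    have k' : 2 * a * A * C * (P ^ 2 - 1) * P + C ^ 2 * A ^ 2 * (P ^ 2 + 1) -
        3 * (P ^ 2 - 1) ^ 2 - 4 * C * (P ^ 2 - 1) = 0 := by
      linear_combination C ^ 2 * k +
        (2 * a * A * P * C - 3 * (P ^ 2 - 1 + C * B ^ 2) - 4 * C) * hsq
    field_simp
    push_cast
    linear_combination -(A * C) * k'
  have hN1 : N 1 = 0 := by simp [hN, nutCoord_one h, fiberRadius]
  have hP1 := one_lt_nutCoord h hx
  rw [hN1] at hconst
  simp only [hN] at hconst
  rw [div_eq_zero_iff, or_iff_left (by linarith)] at hconst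
  have hne : nutCoord u v x - 1 ≠ 0 := by linarith
  apply mul_left_cancel₀ hne
  linear_combination hconst

end Solution

/-! ### The autonomous equation and uniqueness -/

/-- The speed of `√(P - 1)` in the variable `r`, for the ratio `C = λ₂ / λ₁` of the
conformal infinity. The square root desingularises the equation for `P` at the centre `P = 1`. -/
noncomputable def nutSpeed (C t : ℝ) : ℝ := √((t ^ 2 * (t ^ 2 + 4) + 4 * C) / (t ^ 2 + 2)) / 2

theorem nutSpeed_pos {C : ℝ} (hC : 0 < C) (t : ℝ) : 0 < nutSpeed C t := by
  unfold nutSpeed; positivity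

theorem continuous_nutSpeed (C : ℝ) : Continuous (nutSpeed C) := by
  unfold nutSpeed
  have : ∀ t : ℝ, t ^ 2 + 2 ≠ 0 := fun t => by positivity
  fun_prop (disch := assumption)

theorem hasDerivAt_sqrt_nutCoord {lam₁ lam₂ : ℝ} {u v : ℝ → ℝ}
    (h : IsBergerSolution lam₁ lam₂ u v) {x : ℝ} (hx : x ∈ Ioo (0 : ℝ) 1) :
    HasDerivAt (fun x => √(nutCoord u v x - 1))
      (-nutSpeed (Real.exp (v 0)) √(nutCoord u v x - 1) / x) x := by
  have hP := sub_pos.2 (one_lt_nutCoord h hx)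
  have hA := fiberRadius_pos u v hx
  have hsq := fiberRadius_sq h hx
  have h0 := hx.1.ne'
  refine (((hasDerivAt_nutCoord h hx).sub_const 1).sqrt hP.ne').congr_deriv ?_
  have key : Real.exp (v 0) * fiberRadius u v x =
      2 * √(nutCoord u v x - 1) * nutSpeed (Real.exp (v 0)) √(nutCoord u v x - 1) := by
    have hF := nutSpeed_pos (Real.exp_pos (v 0)) √(nutCoord u v x - 1)
    rw [← sq_eq_sq₀ (by positivity) (by positivity)]
    unfold nutSpeed
    rw [mul_pow, mul_pow, mul_pow, div_pow, Real.sq_sqrt hP.le, Real.sq_sqrt (by positivity)]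
    have : nutCoord u v x - 1 + 2 ≠ 0 := by positivity
    field_simp
    linear_combination hsq
  have := (Real.sqrt_pos.2 hP).ne'
  rw [key]
  field_simp

theorem eq_of_radii_eq {u₁ v₁ u₂ v₂ : ℝ → ℝ} {x : ℝ} (hx : x ∈ Ioo (0 : ℝ) 1)
    (hA : fiberRadius u₁ v₁ x = fiberRadius u₂ v₂ x)
    (hB : baseRadius u₁ v₁ x = baseRadius u₂ v₂ x) : u₁ x = u₂ x ∧ v₁ x = v₂ x := by
  have h0 := hx.1
  have h1 : 0 < 1 - x ^ 2 := by nlinarith [hx.1, hx.2]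
  have hs : (1 - x ^ 2) / (2 * x) ≠ 0 := by positivity
  have eA := Real.exp_injective (mul_left_cancel₀ hs hA)
  have eB := Real.exp_injective (mul_left_cancel₀ hs hB)
  constructor <;> linarith

theorem eq_of_isBergerSolution {lam₁ lam₂ : ℝ} {u₁ v₁ u₂ v₂ : ℝ → ℝ}
    (h₁ : IsBergerSolution lam₁ lam₂ u₁ v₁) (h₂ : IsBergerSolution lam₁ lam₂ u₂ v₂) {x : ℝ}
    (hx : x ∈ Ioo (0 : ℝ) 1) : u₁ x = u₂ x ∧ v₁ x = v₂ x := by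
  have hC : Real.exp (v₁ 0) = Real.exp (v₂ 0) := h₁.phi_zero.trans h₂.phi_zero.symm
  have hCpos := Real.exp_pos (v₂ 0)
  have hT : √(nutCoord u₁ v₁ x - 1) = √(nutCoord u₂ v₂ x - 1) :=
    eq_of_autonomous (T₁ := fun x => √(nutCoord u₁ v₁ x - 1))
      (T₂ := fun x => √(nutCoord u₂ v₂ x - 1)) (continuous_nutSpeed (Real.exp (v₂ 0)))
      (nutSpeed_pos hCpos)
      ((continuousOn_nutCoord h₁).sub continuousOn_const).sqrt
      ((continuousOn_nutCoord h₂).sub continuousOn_const).sqrt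
      (by simp [nutCoord_one h₁]) (by simp [nutCoord_one h₂])
      (fun z hz => hC ▸ hasDerivAt_sqrt_nutCoord h₁ hz)
      (fun z hz => hasDerivAt_sqrt_nutCoord h₂ hz) hx
  have hP₁ := one_lt_nutCoord h₁ hx
  have hP₂ := one_lt_nutCoord h₂ hx
  have hP : nutCoord u₁ v₁ x = nutCoord u₂ v₂ x := by
    linarith [(Real.sqrt_inj (sub_nonneg.2 hP₁.le) (sub_nonneg.2 hP₂.le)).1 hT]
  have hA₁ := fiberRadius_sq h₁ hx
  have hA₂ := fiberRadius_sq h₂ hx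
  have hB₁ := nutCoord_sq h₁ hx
  have hB₂ := nutCoord_sq h₂ hx
  rw [hC, hP] at hA₁ hB₁
  refine eq_of_radii_eq hx ?_ ?_
  · have h := mul_right_cancel₀ (by linarith) (hA₁.trans hA₂.symm)
    rw [mul_pow, mul_pow] at h
    exact (sq_eq_sq₀ (fiberRadius_pos _ _ hx).le (fiberRadius_pos _ _ hx).le).1
      (mul_left_cancel₀ (by positivity) h)
  · have h := mul_left_cancel₀ hCpos.ne' (add_left_cancel (hB₁.symm.trans hB₂))
    exact (sq_eq_sq₀ (baseRadius_pos _ _ hx).le (baseRadius_pos _ _ hx).le).1 h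

end Berger

theorem theorem5p3 (lam₁ lam₂ : ℝ) (hlam₁ : 0 < lam₁) (hlam₂ : 0 < lam₂)
    (hrange : (1 / 4 < lam₂ / lam₁ ∧ lam₂ / lam₁ < 1) ∨ (1 < lam₂ / lam₁ ∧ lam₂ / lam₁ < 4))
    (y₁₁ y₁₂ y₂₁ y₂₂ : ℝ → ℝ)
    (h₁ : IsBergerSolution lam₁ lam₂ y₁₁ y₁₂) (h₂ : IsBergerSolution lam₁ lam₂ y₂₁ y₂₂) :
    EqOn y₁₁ y₂₁ (Icc 0 1) ∧ EqOn y₁₂ y₂₂ (Icc 0 1) := by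
  have hcl : Icc (0 : ℝ) 1 ⊆ closure (Ioo 0 1) := (closure_Ioo zero_ne_one).ge
  exact ⟨EqOn.of_subset_closure (fun x hx => (Berger.eq_of_isBergerSolution h₁ h₂ hx).1)
      h₁.smooth₁.continuousOn h₂.smooth₁.continuousOn Ioo_subset_Icc_self hcl,
    EqOn.of_subset_closure (fun x hx => (Berger.eq_of_isBergerSolution h₁ h₂ hx).2)
      h₁.smooth₂.continuousOn h₂.smooth₂.continuousOn Ioo_subset_Icc_self hcl⟩
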